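/- Let $G=(V,E)$ be a finite simple plane graph. A set $D\subseteq V$ is a total dominating set if every vertex of $G$ has a neighbour in $D$; $\gamma_t(G)$ is the smallest size of such a set ($\gamma_t(G)=\infty$ if there is none, i.e. if $G$ has an isolated vertex). For a vertex $v$ let $N_1(v)=\{u\in N(v): N(u)\setminus(N(v)\cup\{v\})\neq\emptyset\}$, $N_2(v)=\{u\in N(v)\setminus N_1(v): N(u)\cap N_1(v)\ne\emptyset\}$, $N_3(v)=N(v)\setminus(N_1(v)\cup N_2(v))$. For distinct vertices $v,w$ let $N(v,w)=(N(v)\cup N(w))\setminus\{v,w\}$ and define $N_1(v,w)=\{u\in N(v,w): N(u)\setminus(N(v,w)\cup\{v,w\})\neq\emptyset\}$, $N_2(v,w)=\{u\in N(v,w)\setminus N_1(v,w): N(u)\cap N_1(v,w)\ne\emptyset\}$, $N_3(v,w)=N(v,w)\setminus(N_1(v,w)\cup N_2(v,w))$. Write $N_{2,3}=N_2\cup N_3$. For $S\subseteq V$, an $S$-total dominating set is a set $D\subseteq S\cup N(S)$ such that every vertex of $S$ has a neighbour in $D$. Let $\mathcal D_v$ be the family of all $D\subseteq N_{2,3}(v,w)\cup\{v\}$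 with $v\in D$, $|D|\le 3$ and $N_3(v,w)\subseteq\bigcup_{u\in D}N(u)$, and let $\mathcal D_w$ be defined symmetrically. A region between two distinct vertices $a,b$ of a plane graph is a closed subset $R$ of the plane whose boundary is formed by two (not necessarily disjoint) simple paths from $a$ to $b$ with at most three edges each, such that all vertices strictly inside $R$ (i.e. in $R$ but not on the two paths) are in $N(a,b)$. Let $V(R)$ be the set of vertices in $R$, including those on the boundary; $|V(R)|$ is the size of $R$. The region is simple if $V(R)\setminus\{a,b\}\subseteq N(a)\cap N(b)$. The maximal simple regions between $a$ and $b$ are obtained from maximal sequences $x_1,\dots,x_k$ of distinct common neighbours of $a$ and $b$ that are consecutive in the circular order around $a$ and such that, for each $i<k$, the closed piece of plane between the paths $a,x_i,b$ and $a,x_{i+1},b$ that contains the corner at $a$ from $x_i$ to $x_{i+1}$ is a simple region; the region of the sequence is the union of these pieces, bounded by the paths $a,x_1,b$ and $a,x_k,b$ (for $k=1$ it is just the path $a,x_1,b$). To shrink a family of regions means: while some region of the family has currently size more than $7$, remove from the graph a vertex strictly inside that region. Rule 2 applies to distinct vertices $v,w$ if there is no $N_3(v,w)$-total dominating set of size at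 most $3$ contained in $N_{2,3}(v,w)$. It transforms $G$ as follows, where all the sets $N_i(\cdot)$, $\mathcal D_v$, $\mathcal D_w$ are those of the original graph $G$, maximal simple regions are those of the current plane graph, and vertices already removed are skipped. Case 1, $\mathcal D_v=\mathcal D_w=\emptyset$: remove $N_3(v,w)$; add a new vertex $v'$ adjacent only to $v$ and a new vertex $w'$ adjacent only to $w$; if $v$ and $w$ have a common neighbour in $N_3(v,w)$, add also a new vertex $y$ adjacent exactly to $v$ and $w$. Case 2, $\mathcal D_v\neq\emptyset$ and $\mathcal D_w\ne\emptyset$: choose any $D\in\mathcal D_v$, and shrink the family of all maximal simple regions between $w$ and $u$, for $u\in D$; then choose any $D'\in\mathcal D_w$, and shrink the family of all maximal simple regions of the resulting graph between $v$ and $u$, for $u\in D'$. Case 3, $\mathcal D_v\ne\emptyset$ and $\mathcal D_w=\emptyset$: add a new vertex $v'$ adjacent only to $v$ (drawn in any face around $v$); choose any $D\in\mathcal D_v$, and shrink the family $\mathcal R$ of all maximal simple regions between $w$ and $u$, for $u\in D\setminus\{v\}$; remove $N_{2,3}(v)\cap N_3(v,w)$; then shrink the family of all maximal simple regions between $v$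 and $u$, for all vertices $u\neq v$ on the boundary of the regions of $\mathcal R$. Case 4, $\mathcal D_v=\emptyset$ and $\mathcal D_w\ne\emptyset$: as Case 3 with $v$ and $w$ exchanged. Then: if Rule 2 applies to the pair $v,w$ of the plane graph $G$ and $G'$ is any graph obtained by its application to $v,w$, then $\gamma_t(G)=\gamma_t(G')$. -/

import Mathlib

universe u

open SimpleGraph

/-! ### Total domination -/

section Domination

variable {V : Type u} (G : SimpleGraph V)

/-- `D` is a total dominating set: every vertex has a neighbour in `D`. -/
def IsTotalDominatingSet (D : Set V) : Prop :=
  ∀ x, ∃ y ∈ D, G.Adj x y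

/-- The size of a smallest total dominating set (`⊤` if there is none, i.e. if some vertex is
isolated). -/
noncomputable def totalDominationNumber : ℕ∞ :=
  ⨅ (D : Set V) (_ : IsTotalDominatingSet G D), D.encard

/-- An `S`-total dominating set: a subset of `S ∪ N(S)` dominating `S` and such that no vertex of
`S` is isolated in `G[D]`. -/
def IsTotalDominatingSetOf (S D : Set V) : Prop :=
  D ⊆ S ∪ {x | ∃ s ∈ S, G.Adj s x} ∧
  (∀ s ∈ S, ∃ d ∈ D, G.Adj s d) ∧
  (∀ s ∈ D, s ∈ S → ∃ d ∈ D, G.Adj s d)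

end Domination

/-! ### The three neighbourhoods of a vertex and of a pair of vertices -/

section Neighborhoods

variable {V : Type u} (G : SimpleGraph V)

def vertexN1 (v : V) : Set V :=
  {x ∈ G.neighborSet v | (G.neighborSet x \ (G.neighborSet v ∪ {v})).Nonempty}

def vertexN2 (v : V) : Set V :=
  {x ∈ G.neighborSet v \ vertexN1 G v | (G.neighborSet x ∩ vertexN1 G v).Nonempty}

def vertexN3 (v : V) : Set V :=
  G.neighborSet v \ (vertexN1 G v ∪ vertexN2 G v)

def pairN (v w : V) : Set V :=
  (G.neighborSet v ∪ G.neighborSet w) \ {v, w}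

def pairN1 (v w : V) : Set V :=
  {x ∈ pairN G v w | (G.neighborSet x \ (pairN G v w ∪ {v, w})).Nonempty}

def pairN2 (v w : V) : Set V :=
  {x ∈ pairN G v w \ pairN1 G v w | (G.neighborSet x ∩ pairN1 G v w).Nonempty}

def pairN3 (v w : V) : Set V :=
  pairN G v w \ (pairN1 G v w ∪ pairN2 G v w)

/-- The family `𝒟_v` of the pair `v, w`; the family `𝒟_w` is `dominatorsWith G w v`. -/
def dominatorsWith (v w : V) : Set (Set V) :=
  {D | D ⊆ (pairN2 G v w ∪ pairN3 G v w) ∪ {v} ∧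
    pairN3 G v w ⊆ ⋃ x ∈ D, G.neighborSet x ∧ D.encard ≤ 3 ∧ v ∈ D}

end Neighborhoods

/-! ### Plane graphs

An embedding of a graph in the oriented sphere (equivalently, in the plane, up to the choice of the
outer face) is recorded by the counterclockwise cyclic order of the edges around each vertex, the
face on the left of each directed edge, and the face that contains each isolated vertex. -/

structure SurfaceEmbedding {V : Type u} (G : SimpleGraph V) where
  /-- the next directed edge, counterclockwise, around the same initial vertex -/
  rot : Equiv.Perm G.Dart
  rot_fst : ∀ d, (rot d).fst = d.fst
  rot_sameCycle : ∀ d e : G.Dart, d.fst = e.fst → rot.SameCycle d e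
  Face : Type u
  /-- the face on the left of a directed edge -/
  face : G.Dart → Face
  /-- the corner between `d` and `rot d` is on the left of `d` and on the right of `rot d` -/
  face_rot_symm : ∀ d, face (rot d).symm = face d
  /-- the face in which an isolated vertex lies -/
  isolatedFace : {x : V // ∀ y, ¬ G.Adj x y} → Face

namespace SurfaceEmbedding

variable {V : Type u} {G : SimpleGraph V} (E : SurfaceEmbedding G)

/-- The vertex `x` lies in the closure of the face `f`. -/
def Incident (x : V) (f : E.Face) : Prop :=
  (∃ d : G.Dart, d.fst = x ∧ E.face d = f) ∨ ∃ h, E.isolatedFace ⟨x, h⟩ = f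

/-- The surface obtained from the embedding is connected and, by Euler's formula
`|V| - |E| + |F| = 1 + c` (with `c` the number of components of the graph), it is the sphere. -/
def IsPlane : Prop :=
  Finite E.Face ∧
  (∀ f g : E.Face,
    Relation.EqvGen (fun f g => ∃ x y, G.Reachable x y ∧ E.Incident x f ∧ E.Incident y g) f g) ∧
  Nat.card V + Nat.card E.Face = Nat.card G.edgeSet + 1 + Nat.card G.ConnectedComponent

/-- After deletion of the vertices outside `S`, the edge `ay` comes immediately after the edge `ax`
in the cyclic order around `a`. -/
def Next (S : Set V) (a x y : V) : Prop :=
  ∃ (hx : G.Adj a x) (hy : G.Adj a y) (n : ℕ), 0 < n ∧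
    (E.rot ^ n) ⟨(a, x), hx⟩ = ⟨(a, y), hy⟩ ∧
    ∀ m, 0 < m → m < n → ((E.rot ^ m) ⟨(a, x), hx⟩).snd ∉ S

/-- A closed set made of two walks from `a` to `b` and of a set of closed faces. -/
structure Region where
  a : V
  b : V
  p : G.Walk a b
  q : G.Walk a b
  faces : Set E.Face

namespace Region

variable {E} (R : E.Region)

/-- The vertices of `R` that are on its two walks (extremities included). -/
def boundary : Set V := {x | x ∈ R.p.support ∨ x ∈ R.q.support}

/-- The vertices of `S` strictly inside `R`. -/
def inside (S : Set V) : Set V :=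
  {x ∈ S | x ∉ R.boundary ∧ ∃ f ∈ R.faces, E.Incident x f}

/-- `V(R)`, in the graph induced by `S`. -/
def verts (S : Set V) : Set V := (R.boundary ∩ S) ∪ R.inside S

/-- `R` is a region between `a` and `b` in the plane graph induced by `S`. A face of the induced
graph is a union of faces of `G`, merged across the deleted edges. -/
structure IsRegion (S : Set V) : Prop where
  ne : R.a ≠ R.b
  p_path : R.p.IsPath
  q_path : R.q.IsPath
  p_length : R.p.length ≤ 3
  q_length : R.q.length ≤ 3
  boundary_subset : R.boundary ⊆ S
  /-- `R` is a union of faces of the induced graph -/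
  saturated : ∀ d : G.Dart, d.fst ∉ S ∨ d.snd ∉ S →
    (E.face d ∈ R.faces ↔ E.face d.symm ∈ R.faces)
  /-- the edges with only one side in `R` are those on exactly one of the two paths -/
  frontier : ∀ d : G.Dart, d.fst ∈ S → d.snd ∈ S →
    (Xor (E.face d ∈ R.faces) (E.face d.symm ∈ R.faces) ↔
      Xor (d.edge ∈ R.p.edges) (d.edge ∈ R.q.edges))
  /-- an edge common to the two paths is on the frontier of `R`, so no side of it is in `R` -/
  shared : ∀ d : G.Dart, d.edge ∈ R.p.edges → d.edge ∈ R.q.edges → E.face d ∉ R.faces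
  inside_subset : R.inside S ⊆ pairN G R.a R.b

/-- `R` is a simple region: all its vertices but `a`, `b` are common neighbours of `a` and `b`. -/
structure IsSimpleRegion (S : Set V) : Prop extends R.IsRegion S where
  common : R.verts S \ {R.a, R.b} ⊆ G.neighborSet R.a ∩ G.neighborSet R.b

end Region

/-- The closed set with faces `F` between the paths `a, x, b` and `a, y, b`. -/
def between {a b x y : V} (hx : G.Adj a x) (hx' : G.Adj x b) (hy : G.Adj a y) (hy' : G.Adj y b)
    (F : Set E.Face) : E.Region where
  a := a
  b := b
  p := Walk.cons hx (Walk.cons hx' Walk.nil)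
  q := Walk.cons hy (Walk.cons hy' Walk.nil)
  faces := F

/-- Common neighbours `x 0, …, x n` of `a` and `b` that are consecutive around `a` in the plane
graph induced by `S`. Each is added to the previous ones together with the piece of plane between
`a, x i, b` and `a, x (i + 1), b` which contains the corner at `a` between them; this piece has to
be a simple region. -/
structure Run (S : Set V) (a b : V) where
  n : ℕ
  x : Fin (n + 1) → V
  injective : Function.Injective x
  adj_left : ∀ i, G.Adj a (x i)
  adj_right : ∀ i, G.Adj (x i) b
  next : ∀ i : Fin n, E.Next S a (x i.castSucc) (x i.succ)
  piece : Fin n → Set E.Face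
  corner : ∀ i : Fin n, E.face ⟨(a, x i.castSucc), adj_left i.castSucc⟩ ∈ piece i
  simple : ∀ i : Fin n, (E.between (adj_left i.castSucc) (adj_right i.castSucc)
    (adj_left i.succ) (adj_right i.succ) (piece i)).IsSimpleRegion S

/-- The region covered by a run: the union of its pieces, between the paths through its first and
its last vertex. -/
def Run.region {E : SurfaceEmbedding G} {S : Set V} {a b : V} (r : E.Run S a b) : E.Region :=
  E.between (r.adj_left 0) (r.adj_right 0) (r.adj_left (Fin.last r.n)) (r.adj_right (Fin.last r.n))
    (⋃ i, r.piece i)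

/-- The simple regions between `a` and `b` made of consecutive common neighbours around `a`. -/
def runRegions (S : Set V) (a b : V) : Set E.Region :=
  {R | ∃ r : E.Run S a b, R = r.region ∧ R.IsSimpleRegion S}

/-- The maximal simple regions between `a` and `b`, in the plane graph induced by `S`. -/
def maximalSimpleRegions (S : Set V) (a b : V) : Set E.Region :=
  {R ∈ E.runRegions S a b | ∀ R' ∈ E.runRegions S a b,
    R.faces ⊆ R'.faces → R.verts S ⊆ R'.verts S → R'.verts S ⊆ R.verts S}

/-- One removal: from the vertex set `S` to `T`, a vertex strictly inside a region of the family
`𝓡` that has currently more than 7 vertices is removed. -/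
def ShrinkStep (𝓡 : Set E.Region) (S T : Set V) : Prop :=
  ∃ R ∈ 𝓡, 7 < (R.verts S).encard ∧ ∃ x ∈ R.inside S, T = S \ {x}

/-- The loop "while there is a region of size more than 7 in `𝓡`, remove a vertex strictly inside
that region", started with the vertex set `S`, can end with the vertex set `T`. -/
def Shrink (𝓡 : Set E.Region) (S T : Set V) : Prop :=
  Relation.ReflTransGen (E.ShrinkStep 𝓡) S T ∧ ∀ R ∈ 𝓡, (R.verts T).encard ≤ 7

end SurfaceEmbedding

/-! ### Adding vertices -/

/-- `G` with a new vertex `none` adjacent to `v` only. -/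
def addPendant {V : Type u} (G : SimpleGraph V) (v : V) : SimpleGraph (Option V) where
  Adj
    | some x, some y => G.Adj x y
    | some x, none => x = v
    | none, some y => y = v
    | none, none => False
  symm := ⟨by
    rintro (_ | x) (_ | y) h
    · exact h
    · exact h
    · exact h
    · exact G.adj_symm h⟩
  loopless := ⟨by
    rintro (_ | x) h
    · exact h
    · exact G.loopless.irrefl x h⟩

/-- The embedding `E'` of `G` plus a pendant vertex at `v` is plane and extends the embedding `E`
of `G`: the new edge is drawn inside one of the faces around `v`. -/
def SurfaceEmbedding.Extends {V : Type u} {G : SimpleGraph V} {v : V}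
    (E' : SurfaceEmbedding (addPendant G v)) (E : SurfaceEmbedding G) : Prop :=
  E'.IsPlane ∧
  (∀ a x y, E.Next Set.univ a x y ↔ E'.Next (Set.range some) (some a) (some x) (some y)) ∧
  ∃ e : E.Face ≃ E'.Face,
    (∀ (d : G.Dart) (h : (addPendant G v).Adj (some d.fst) (some d.snd)),
      E'.face ⟨(some d.fst, some d.snd), h⟩ = e (E.face d)) ∧
    (∀ x f, E.Incident x f → E'.Incident (some x) (e f))

/-- Names for the new vertices of the first case of the rule. -/
inductive NewVertex
  | v'
  | w'
  | y

/-- `G` with new vertices `v'` adjacent to `v`, `w'` adjacent to `w`, and `y` adjacent to `v` and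
`w`. -/
def addThree {V : Type u} (G : SimpleGraph V) (v w : V) : SimpleGraph (V ⊕ NewVertex) :=
  SimpleGraph.fromRel fun
    | .inl a, .inl b => G.Adj a b
    | .inl a, .inr .v' => a = v
    | .inl a, .inr .w' => a = w
    | .inl a, .inr .y => a = v ∨ a = w
    | _, _ => False

/-- The vertices that remain or are added in the first case: `N₃(v,w)` is removed, and `y` is added
only if `v` and `w` have a common neighbour in `N₃(v,w)`. -/
def case1Verts {V : Type u} (G : SimpleGraph V) (v w : V) : Set (V ⊕ NewVertex) :=
  {z | match z with
    | .inl a => a ∉ pairN3 G v w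
    | .inr .v' => True
    | .inr .w' => True
    | .inr .y => ∃ x ∈ pairN3 G v w, G.Adj v x ∧ G.Adj w x}

/-! ### The rule -/

namespace SurfaceEmbedding

variable {V : Type u} {G : SimpleGraph V}

/-- The transformation of the case `𝒟_v ≠ ∅`, `𝒟_w = ∅`. The set of vertices of the current graph
goes from `univ` to `S₁`, then to `S₁ \ (N₂₃(v) ∩ N₃(v,w))`, then to `S₂`. -/
inductive PairRuleOneSided (E : SurfaceEmbedding G) (v w : V) : (W : Type u) → SimpleGraph W → Prop
  | mk (E' : SurfaceEmbedding (addPendant G v)) (hE' : E'.Extends E)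
      (D : Set V) (hD : D ∈ dominatorsWith G v w)
      (𝓡₁ : Set E'.Region)
      (h𝓡₁ : 𝓡₁ = ⋃ x ∈ D \ {v}, E'.maximalSimpleRegions Set.univ (some w) (some x))
      (S₁ : Set (Option V)) (hS₁ : E'.Shrink 𝓡₁ Set.univ S₁)
      (T : Set (Option V))
      (hT : T = S₁ \ some '' ((vertexN2 G v ∪ vertexN3 G v) ∩ pairN3 G v w))
      (𝓡₂ : Set E'.Region)
      (h𝓡₂ : 𝓡₂ = ⋃ R ∈ 𝓡₁, ⋃ z ∈ (R.boundary ∩ T) \ {some v},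
        E'.maximalSimpleRegions T (some v) z)
      (S₂ : Set (Option V)) (hS₂ : E'.Shrink 𝓡₂ T S₂) :
      PairRuleOneSided E v w S₂ ((addPendant G v).induce S₂)

/-- There is no `N₃(v,w)`-total dominating set of size at most 3 in `N₂₃(v,w)`. -/
def PairRuleApplicable (G : SimpleGraph V) (v w : V) : Prop :=
  ¬ ∃ D : Set V, D ⊆ pairN2 G v w ∪ pairN3 G v w ∧ D.encard ≤ 3 ∧
    IsTotalDominatingSetOf G (pairN3 G v w) D

/-- `PairRule E v w W G'`: the reduction rule applies to the pair `v, w` of the graph `G` with the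
embedding `E`, and the graph `G'` (with vertex set `W`) is a possible result. -/
inductive PairRule (E : SurfaceEmbedding G) (v w : V) : (W : Type u) → SimpleGraph W → Prop
  | case1 (h : PairRuleApplicable G v w)
      (hv : dominatorsWith G v w = ∅) (hw : dominatorsWith G w v = ∅) :
      PairRule E v w (case1Verts G v w) ((addThree G v w).induce (case1Verts G v w))
  | case2 (h : PairRuleApplicable G v w)
      (Dv : Set V) (hv : Dv ∈ dominatorsWith G v w)
      (Dw : Set V) (hw : Dw ∈ dominatorsWith G w v)
      (S₁ : Set V)
      (hS₁ : E.Shrink (⋃ x ∈ Dv, E.maximalSimpleRegions Set.univ w x) Set.univ S₁)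
      (S₂ : Set V)
      (hS₂ : E.Shrink (⋃ x ∈ Dw, E.maximalSimpleRegions S₁ v x) S₁ S₂) :
      PairRule E v w S₂ (G.induce S₂)
  | case3 (h : PairRuleApplicable G v w)
      (hv : (dominatorsWith G v w).Nonempty) (hw : dominatorsWith G w v = ∅)
      (W : Type u) (G' : SimpleGraph W) (hG' : PairRuleOneSided E v w W G') :
      PairRule E v w W G'
  | case4 (h : PairRuleApplicable G v w)
      (hv : dominatorsWith G v w = ∅) (hw : (dominatorsWith G w v).Nonempty)
      (W : Type u) (G' : SimpleGraph W) (hG' : PairRuleOneSided E w v W G') :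
      PairRule E v w W G'

end SurfaceEmbedding

/-! Every operation of the rule is shown to preserve the total domination number by exchanging
vertices in dominating sets without increasing their size.

Shrinking (`Shrink.totalDominationNumber_eq`). In a maximal simple region between `a` and `b`, the
vertices other than `a` and `b` are common neighbours `x 0, …, x n` consecutive around `a`. The
piece between two successive ones contains no other vertex, so an inner vertex can be adjacent only
to `a`, `b` and the vertices just before and after it. The boundary has at most four vertices, so a
region of size more than 7 has at least four inner ones. The inner vertices are then
interchangeable: besides dominating `a` and `b`, an inner vertex dominates only vertices that `a`
dominates as well. Hence one of them can be deleted (`totalDominationNumber_induce_diff_singleton`).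
This settles Case 2.

Forcing `v` and `w` (`exists_isTotalDominatingSet_pair_subset`). If `𝒟_w` is empty, a total
dominating set avoiding `v` uses at least three vertices of `N₂₃(v,w)`, and at least four if it also
avoids `w`, since the rule applies. These vertices have no neighbour outside `N(v,w) ∪ {v,w}`, so
they can be traded for `v`, `w` and one dominating neighbour of each. Thus `v` and `w` may be
assumed to be in the set, which is what the pendant vertices `v'` and `w'` encode.

In Case 1, `N₃(v,w)` then serves only to dominate `v` and `w`, a task taken over by `v'`, `w'` and
`y`. In Case 3, the pendant vertex forces `v`, the vertices of `N₂₃(v)` become useless except for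
dominating `v`, and the rest is shrinking; Case 4 is symmetric. -/

/-! ### Total domination inside a vertex set -/

section RelativeDomination

/-- `D ⊆ S` is a total dominating set of the graph induced by `S`. -/
def IsTotalDominatingSetIn {W : Type*} (G : SimpleGraph W) (S D : Set W) : Prop :=
  D ⊆ S ∧ ∀ x ∈ S, ∃ y ∈ D, G.Adj x y

/-- Successive deletions can thus be compared through sets of vertices of one fixed type, rather
than through nested subtypes. -/
theorem totalDominationNumber_induce {W : Type u} (G : SimpleGraph W) (S : Set W) :
    totalDominationNumber (G.induce S) =
      ⨅ (D : Set W) (_ : IsTotalDominatingSetIn G S D), D.encard := by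
  unfold totalDominationNumber
  apply le_antisymm
  · refine le_iInf₂ fun D hD => ?_
    refine (iInf₂_le (Subtype.val ⁻¹' D) ?_).trans ?_
    · intro x
      obtain ⟨y, hy, hxy⟩ := hD.2 x x.2
      exact ⟨⟨y, hD.1 hy⟩, hy, hxy⟩
    · rw [← Subtype.val_injective.encard_image, Subtype.image_preimage_coe]
      exact Set.encard_le_encard Set.inter_subset_right
  · refine le_iInf₂ fun D hD => ?_
    refine (iInf₂_le (Subtype.val '' D) ?_).trans (Set.encard_image_le _ _)
    refine ⟨by rintro _ ⟨x, -, rfl⟩; exact x.2, fun x hx => ?_⟩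
    obtain ⟨y, hy, hxy⟩ := hD ⟨x, hx⟩
    exact ⟨y, ⟨y, hy, rfl⟩, hxy⟩

theorem totalDominationNumber_eq_induce_univ {W : Type u} (G : SimpleGraph W) :
    totalDominationNumber G = totalDominationNumber (G.induce Set.univ) := by
  rw [totalDominationNumber_induce]
  simp [totalDominationNumber, IsTotalDominatingSetIn, IsTotalDominatingSet]

theorem totalDominationNumber_induce_le {W : Type u} {W' : Type u} {G : SimpleGraph W}
    {H : SimpleGraph W'} {S : Set W} {T : Set W'}
    (h : ∀ D, IsTotalDominatingSetIn G S D →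
      ∃ D', IsTotalDominatingSetIn H T D' ∧ D'.encard ≤ D.encard) :
    totalDominationNumber (H.induce T) ≤ totalDominationNumber (G.induce S) := by
  rw [totalDominationNumber_induce, totalDominationNumber_induce]
  refine le_iInf₂ fun D hD => ?_
  obtain ⟨D', hD', hle⟩ := h D hD
  exact (iInf₂_le D' hD').trans hle

theorem encard_diff_union_le {W : Type*} {D A B : Set W} (h : B.encard ≤ (D ∩ A).encard) :
    ((D \ A) ∪ B).encard ≤ D.encard := by
  rw [← Set.encard_sdiff_add_encard_inter D A]
  exact (Set.encard_union_le _ _).trans (by gcongr)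

theorem encard_insert_diff_singleton_le {W : Type*} {D : Set W} {x : W} (y : W) (hx : x ∈ D) :
    (insert y (D \ {x})).encard ≤ D.encard := by
  rw [← Set.encard_sdiff_singleton_add_one hx]
  exact Set.encard_insert_le _ _

/-- Among at least four common neighbours `I` of `a` and `b` whose other neighbours are in `I` or
among two further common neighbours `p`, `q`, each of which has at most one neighbour in `I`, one
vertex can be deleted without changing the total domination number. -/
theorem totalDominationNumber_induce_diff_singleton {W : Type u} (G : SimpleGraph W)
    {S I : Set W} {a b p q x : W} (ha : a ∈ S) (hIS : I ⊆ S)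
    (hI : ∀ y ∈ I, G.Adj a y ∧ G.Adj b y)
    (hp : G.Adj a p ∧ G.Adj b p) (hq : G.Adj a q ∧ G.Adj b q)
    (hN : ∀ y ∈ I, ∀ z ∈ S, G.Adj y z → z = a ∨ z = b ∨ z = p ∨ z = q ∨ z ∈ I)
    (hpI : {y ∈ I | G.Adj y p}.Subsingleton) (hqI : {y ∈ I | G.Adj y q}.Subsingleton)
    (hcard : 4 ≤ I.encard) (hx : x ∈ I) :
    totalDominationNumber (G.induce S) = totalDominationNumber (G.induce (S \ {x})) := by
  have haI : a ∉ I := fun h => G.loopless.irrefl a (hI a h).1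
  have hcard' : 3 ≤ (I \ {x}).encard := by
    rw [← Set.encard_sdiff_singleton_add_one hx] at hcard
    exact (ENat.add_le_add_iff_right ENat.one_ne_top).1 hcard
  have hax : a ∈ S \ {x} := ⟨ha, fun h => haI (h ▸ hx)⟩
  have hcommon : ∀ z, z = p ∨ z = q ∨ z ∈ I → G.Adj a z ∧ G.Adj b z := by
    rintro z (rfl | rfl | h)
    exacts [hp, hq, hI z h]
  -- replacing an inner vertex by `a`
  have key : ∀ (T D : Set W), T ⊆ S → a ∈ T → (∀ s ∈ T, s ∉ I → ∃ y ∈ D, G.Adj s y) → ∀ y ∈ I,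
      (∃ z ∈ D, z ≠ y ∧ (z = p ∨ z = q ∨ z ∈ I)) → D \ {y} ⊆ T →
      IsTotalDominatingSetIn G T (insert a (D \ {y})) := by
    intro T D hTS haT hD y hy ⟨z, hzD, hzy, hz⟩ hDT
    -- The new `a` dominates `p`, `q` and `I`, while `z` still dominates `a` and `b`; by `hN` the
    -- removed `y` had no other neighbour in `S`.
    refine ⟨Set.insert_subset haT hDT, fun s hs => ?_⟩
    by_cases hs' : s = p ∨ s = q ∨ s ∈ I
    · exact ⟨a, Set.mem_insert _ _, (hcommon s hs').1.symm⟩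
    by_cases hsa : s = a
    · exact ⟨z, Or.inr ⟨hzD, hzy⟩, hsa ▸ (hcommon z hz).1⟩
    by_cases hsb : s = b
    · exact ⟨z, Or.inr ⟨hzD, hzy⟩, hsb ▸ (hcommon z hz).2⟩
    obtain ⟨t, htD, hst⟩ := hD s hs (fun h => hs' (Or.inr (Or.inr h)))
    refine ⟨t, Or.inr ⟨htD, ?_⟩, hst⟩
    rintro rfl
    have := hN t hy s (hTS hs) hst.symm
    tauto
  apply le_antisymm
  · refine totalDominationNumber_induce_le fun D hD => ?_
    by_cases hab : a ∈ D ∨ b ∈ D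
    · refine ⟨D, ⟨hD.1.trans Set.sdiff_subset, fun s hs => ?_⟩, le_rfl⟩
      by_cases hsx : s = x
      · subst hsx
        rcases hab with h | h
        exacts [⟨a, h, (hI s hx).1.symm⟩, ⟨b, h, (hI s hx).2.symm⟩]
      · exact hD.2 s ⟨hs, hsx⟩
    -- Without `a` and `b`, the at least three vertices of `I \ {x}` are dominated from `p`, `q` and
    -- `I`. Each of `p`, `q` serves at most one of them, so `D` meets `I`, and a vertex of `D ∩ I`
    -- can be exchanged for `a`, which dominates `x`.
    have hnb : ∀ y ∈ I, y ≠ x → ∃ z ∈ D, G.Adj y z ∧ (z = p ∨ z = q ∨ z ∈ I) := by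
      intro y hy hyx
      obtain ⟨z, hz, hyz⟩ := hD.2 y ⟨hIS hy, hyx⟩
      refine ⟨z, hz, hyz, ?_⟩
      rcases hN y hy z (hD.1 hz).1 hyz with rfl | rfl | h
      exacts [absurd (Or.inl hz) hab, absurd (Or.inr hz) hab, h]
    have hy : ∃ y ∈ I, y ∈ D := by
      by_contra! hno
      have hsub : I \ {x} ⊆ {y ∈ I | G.Adj y p} ∪ {y ∈ I | G.Adj y q} := by
        rintro y ⟨hy, hyx⟩
        obtain ⟨z, hz, hyz, rfl | rfl | h⟩ := hnb y hy hyx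
        exacts [Or.inl ⟨hy, hyz⟩, Or.inr ⟨hy, hyz⟩, absurd hz (hno z h)]
      have h2 : (I \ {x}).encard ≤ 1 + 1 :=
        ((Set.encard_le_encard hsub).trans (Set.encard_union_le _ _)).trans
          (add_le_add (Set.encard_le_one_iff_subsingleton.2 hpI)
            (Set.encard_le_one_iff_subsingleton.2 hqI))
      exact absurd (hcard'.trans h2) (by norm_num)
    obtain ⟨y, hyI, hyD⟩ := hy
    refine ⟨insert a (D \ {y}), key S D subset_rfl ha ?_ y hyI ?_ ?_,
      encard_insert_diff_singleton_le a hyD⟩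
    · exact fun s hs hsI => hD.2 s ⟨hs, fun h => hsI (h ▸ hx)⟩
    · obtain ⟨z, hz, hyz, h⟩ := hnb y hyI (hD.1 hyD).2
      exact ⟨z, hz, hyz.ne', h⟩
    · exact fun z hz => (hD.1 hz.1).1
  · refine totalDominationNumber_induce_le fun D hD => ?_
    by_cases hxD : x ∈ D
    swap
    · exact ⟨D, ⟨fun z hz => ⟨hD.1 hz, fun h => hxD (h ▸ hz)⟩, fun s hs => hD.2 s hs.1⟩, le_rfl⟩
    have hsub : D \ {x} ⊆ S \ {x} := Set.sdiff_subset_sdiff_left hD.1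
    -- If `a` or `b` is in `D`, then `x` is needed only to dominate `a` and `b`, which any other
    -- inner vertex does. Otherwise `x` is exchanged for `a`.
    by_cases hab : a ∈ D ∨ b ∈ D
    · have hne : (I \ {x}).Nonempty := by
        rw [← Set.encard_ne_zero]
        rintro h
        rw [h] at hcard'
        exact absurd hcard' (by norm_num)
      obtain ⟨y, hyI, hyx⟩ := hne
      refine ⟨insert y (D \ {x}), ⟨Set.insert_subset ⟨hIS hyI, hyx⟩ hsub, fun s hs => ?_⟩,
        encard_insert_diff_singleton_le y hxD⟩
      by_cases hsa : s = a
      · exact ⟨y, Set.mem_insert _ _, hsa ▸ (hI y hyI).1⟩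
      by_cases hsb : s = b
      · exact ⟨y, Set.mem_insert _ _, hsb ▸ (hI y hyI).2⟩
      by_cases hs' : s = p ∨ s = q ∨ s ∈ I
      · rcases hab with h | h
        · exact ⟨a, Or.inr ⟨h, (hI x hx).1.ne⟩, (hcommon s hs').1.symm⟩
        · exact ⟨b, Or.inr ⟨h, (hI x hx).2.ne⟩, (hcommon s hs').2.symm⟩
      obtain ⟨t, htD, hst⟩ := hD.2 s hs.1
      refine ⟨t, Or.inr ⟨htD, ?_⟩, hst⟩
      rintro rfl
      have := hN t hx s hs.1 hst.symm
      tauto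
    · refine ⟨insert a (D \ {x}), key _ D Set.sdiff_subset hax (fun s hs _ => hD.2 s hs.1) x hx ?_
        hsub, encard_insert_diff_singleton_le a hxD⟩
      obtain ⟨z, hz, hxz⟩ := hD.2 x (hIS hx)
      refine ⟨z, hz, hxz.ne', ?_⟩
      rcases hN x hx z (hD.1 hz) hxz with rfl | rfl | h
      exacts [absurd (Or.inl hz) hab, absurd (Or.inr hz) hab, h]

end RelativeDomination

/-! ### Vertices inside simple regions -/

namespace SurfaceEmbedding

variable {V : Type u} {G : SimpleGraph V} {E : SurfaceEmbedding G}

theorem face_symm_eq (E : SurfaceEmbedding G) (d : G.Dart) :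
    E.face d.symm = E.face (E.rot.symm d) := by
  simpa using E.face_rot_symm (E.rot.symm d)

theorem rot_symm_fst (E : SurfaceEmbedding G) (d : G.Dart) : (E.rot.symm d).fst = d.fst := by
  simpa using (E.rot_fst (E.rot.symm d)).symm

theorem rot_pow_fst (E : SurfaceEmbedding G) (d : G.Dart) (k : ℕ) :
    ((E.rot ^ k) d).fst = d.fst := by
  induction k with
  | zero => rfl
  | succ k ih => rw [pow_succ', Equiv.Perm.mul_apply, E.rot_fst, ih]

theorem incident_fst (E : SurfaceEmbedding G) (d : G.Dart) : E.Incident d.fst (E.face d) :=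
  Or.inl ⟨d, rfl, rfl⟩

/-- The dart `E.rot.symm d.symm` follows `d` along the face on its left. -/
theorem incident_snd (E : SurfaceEmbedding G) (d : G.Dart) : E.Incident d.snd (E.face d) :=
  Or.inl ⟨E.rot.symm d.symm, E.rot_symm_fst _, by rw [← E.face_symm_eq, Dart.symm_symm]⟩

namespace Region

variable {R : E.Region} {S : Set V}

theorem IsRegion.face_mem_iff_symm (h : R.IsRegion S) {d : G.Dart} (hp : d.edge ∉ R.p.edges)
    (hq : d.edge ∉ R.q.edges) : E.face d ∈ R.faces ↔ E.face d.symm ∈ R.faces := by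
  by_cases hd : d.fst ∉ S ∨ d.snd ∉ S
  · exact h.saturated d hd
  · push Not at hd
    have := h.frontier d hd.1 hd.2
    simp only [Xor, hp, hq] at this
    tauto

/-- All the faces around a vertex strictly inside a region belong to the region. -/
theorem IsRegion.face_mem_of_mem_inside (h : R.IsRegion S) {y : V} (hy : y ∈ R.inside S)
    (d : G.Dart) (hd : d.fst = y) : E.face d ∈ R.faces := by
  obtain ⟨-, hyb, f, hf, hyf⟩ := hy
  rcases hyf with ⟨d₀, hd₀, rfl⟩ | ⟨hiso, -⟩
  swap
  · subst hd
    exact absurd d.adj (hiso _)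
  have hedge : ∀ e : G.Dart, e.fst = y → e.edge ∉ R.p.edges ∧ e.edge ∉ R.q.edges := by
    rintro e rfl
    exact ⟨fun he => hyb (Or.inl (R.p.fst_mem_support_of_mem_edges he)),
      fun he => hyb (Or.inr (R.q.fst_mem_support_of_mem_edges he))⟩
  -- An edge at `y` lies on neither path, so turning around `y` never leaves the region;
  -- `rot_sameCycle` makes the turn reach every dart at `y`.
  have hstep : ∀ e : G.Dart, e.fst = y →
      (E.face e ∈ R.faces ↔ E.face (E.rot e) ∈ R.faces) := by
    intro e he
    obtain ⟨h1, h2⟩ := hedge (E.rot e) ((E.rot_fst e).trans he)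
    rw [h.face_mem_iff_symm h1 h2, E.face_rot_symm]
  obtain ⟨i, rfl⟩ := E.rot_sameCycle d₀ d (hd₀.trans hd.symm)
  clear hd
  have hall : ((E.rot ^ i) d₀).fst = y ∧ E.face ((E.rot ^ i) d₀) ∈ R.faces := by
    induction i using Int.induction_on with
    | zero => exact ⟨hd₀, hf⟩
    | succ i ih =>
      rw [add_comm, zpow_add, zpow_one, Equiv.Perm.mul_apply]
      exact ⟨(E.rot_fst _).trans ih.1, (hstep _ ih.1).1 ih.2⟩
    | pred i ih =>
      have heq : (E.rot ^ (-(i : ℤ))) d₀ = E.rot ((E.rot ^ (-(i : ℤ) - 1)) d₀) := by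
        rw [← Equiv.Perm.mul_apply, ← zpow_one_add]
        congr 2
        ring
      rw [heq, E.rot_fst] at ih
      exact ⟨ih.1, (hstep _ ih.1).2 ih.2⟩
  exact hall.2

theorem IsRegion.face_mem_of_mem_inside' (h : R.IsRegion S) {y : V} (hy : y ∈ R.inside S)
    (d : G.Dart) (hd : d.snd = y) : E.face d ∈ R.faces := by
  have := E.face_symm_eq d.symm
  rw [Dart.symm_symm] at this
  rw [this]
  exact h.face_mem_of_mem_inside hy _ ((E.rot_symm_fst _).trans hd)

theorem IsRegion.mem_verts_of_adj (h : R.IsRegion S) {y z : V} (hy : y ∈ R.inside S)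
    (hz : z ∈ S) (hyz : G.Adj y z) : z ∈ R.verts S := by
  by_cases hzb : z ∈ R.boundary
  · exact Or.inl ⟨hzb, hz⟩
  · exact Or.inr ⟨hz, hzb, _, h.face_mem_of_mem_inside hy ⟨(y, z), hyz⟩ rfl,
      E.incident_snd ⟨(y, z), hyz⟩⟩

theorem a_mem_boundary (R : E.Region) : R.a ∈ R.boundary := Or.inl R.p.start_mem_support

theorem b_mem_boundary (R : E.Region) : R.b ∈ R.boundary := Or.inl R.p.end_mem_support

theorem IsSimpleRegion.adj_of_mem_inside (h : R.IsSimpleRegion S) {y : V}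
    (hy : y ∈ R.inside S) : G.Adj R.a y ∧ G.Adj R.b y := by
  refine h.common ⟨Or.inr hy, ?_⟩
  rintro (rfl | rfl)
  exacts [hy.2.1 R.a_mem_boundary, hy.2.1 R.b_mem_boundary]

theorem inside_mono (R : E.Region) {S T : Set V} (h : S ⊆ T) : R.inside S ⊆ R.inside T :=
  fun _ hx => ⟨h hx.1, hx.2⟩

end Region

theorem mem_boundary_between {a b x y : V} (hx : G.Adj a x) (hx' : G.Adj x b) (hy : G.Adj a y)
    (hy' : G.Adj y b) (F : Set E.Face) (z : V) :
    z ∈ (E.between hx hx' hy hy' F).boundary ↔ z = a ∨ z = b ∨ z = x ∨ z = y := by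
  simp only [Region.boundary, between, Walk.support_cons, Walk.support_nil, List.mem_cons,
    List.not_mem_nil, or_false, Set.mem_ofPred_eq]
  tauto

/-- There is no vertex strictly inside a simple region between two consecutive common
neighbours. -/
theorem not_mem_inside_between_of_next [Finite V] {S : Set V} {a b x y : V} (hx : G.Adj a x)
    (hx' : G.Adj x b) (hy : G.Adj a y) (hy' : G.Adj y b) (F : Set E.Face) (hxy : x ≠ y)
    (hnext : E.Next S a x y) (hcorner : E.face ⟨(a, x), hx⟩ ∈ F)
    (h : (E.between hx hx' hy hy' F).IsSimpleRegion S) (z : V) :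
    z ∉ (E.between hx hx' hy hy' F).inside S := by
  -- Turn around `a` starting from `ax`: the faces met belong to `F` until `ay` is crossed, and from
  -- then on lie outside `F` until `ax` comes back. Since `z` is in `S`, it is met after `y` and
  -- before this return, yet the face at `az` is in `F`.
  intro hz
  have haz : G.Adj a z := (h.adj_of_mem_inside hz).1
  have hzF : E.face ⟨(a, z), haz⟩ ∈ F := h.toIsRegion.face_mem_of_mem_inside' hz _ rfl
  have hab : a ≠ b := h.ne
  have hzb := hz.2.1
  rw [mem_boundary_between] at hzb
  push Not at hzb
  obtain ⟨-, -, hzx, hzy⟩ := hzb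
  have hyS : y ∈ S := h.boundary_subset ((mem_boundary_between hx hx' hy hy' F y).2 (by simp))
  have haS : a ∈ S := h.boundary_subset ((mem_boundary_between hx hx' hy hy' F a).2 (by simp))
  -- crossing an edge at `a` other than `ax` and `ay`
  have hcross : ∀ d : G.Dart, d.fst = a → d.snd ≠ x → d.snd ≠ y →
      (E.face d ∈ F ↔ E.face d.symm ∈ F) := by
    rintro ⟨⟨a', t⟩, hat⟩ rfl htx hty
    refine h.toIsRegion.face_mem_iff_symm ?_ ?_
    · simp only [between, Walk.edges_cons, Walk.edges_nil, List.mem_cons, Dart.edge_mk,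
        List.not_mem_nil, or_false, Sym2.eq_iff]
      have := hx.ne
      simp_all
    · simp only [between, Walk.edges_cons, Walk.edges_nil, List.mem_cons, Dart.edge_mk,
        List.not_mem_nil, or_false, Sym2.eq_iff]
      have := hy.ne
      simp_all
  obtain ⟨_, _, n, hn, hny, hmid⟩ := hnext
  set d : G.Dart := ⟨(a, x), hx⟩ with hd
  have hfst : ∀ m, ((E.rot ^ m) d).fst = a := fun m => E.rot_pow_fst d m
  have hsucc : ∀ m, E.face ((E.rot ^ (m + 1)) d).symm = E.face ((E.rot ^ m) d) := by
    intro m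
    rw [pow_succ', Equiv.Perm.mul_apply, E.face_rot_symm]
  -- the first turn to `z`
  have hfin : Finite G.Dart := Finite.of_injective _ Dart.toProd_injective
  have hex : ∃ m, (E.rot ^ m) d = ⟨(a, z), haz⟩ := by
    obtain ⟨m, -, hm⟩ := (E.rot_sameCycle d ⟨(a, z), haz⟩ rfl).exists_pow_eq'
    exact ⟨m, hm⟩
  classical
  set K := Nat.find hex with hK
  have hKz : (E.rot ^ K) d = ⟨(a, z), haz⟩ := Nat.find_spec hex
  -- A return to `ax` after `m` turns would give an earlier visit to `az`, after `K - m` turns.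
  have hnoret : ∀ m, 0 < m → m ≤ K → (E.rot ^ m) d ≠ d := by
    intro m hm hmK hmd
    refine Nat.find_min hex (m := K - m) (by omega) ?_
    rw [← hKz]
    conv_rhs => rw [← Nat.sub_add_cancel hmK, pow_add, Equiv.Perm.mul_apply, hmd]
  have hnK : n < K := by
    by_contra! hle
    rcases hle.lt_or_eq with hlt | heq
    · have hK0 : 0 < K := by
        rcases Nat.eq_zero_or_pos K with h0 | h0
        · rw [h0, pow_zero] at hKz
          have := congrArg (fun e : G.Dart => e.snd) hKz
          exact absurd this.symm hzx
        · exact h0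
      have := hmid K hK0 hlt
      rw [hKz] at this
      exact this hz.1
    · rw [heq, hny] at hKz
      have := congrArg (fun e : G.Dart => e.snd) hKz
      exact hzy this.symm
  have hin : ∀ m, m < n → E.face ((E.rot ^ m) d) ∈ F := by
    intro m
    induction m with
    | zero => exact fun _ => hcorner
    -- The edges strictly between `ax` and `ay` lead to deleted vertices, so their two sides are
    -- both in `F` or both outside.
    | succ m ih =>
      intro hm
      have hnS := hmid (m + 1) (Nat.succ_pos m) hm
      rw [← hsucc] at ih
      exact (h.saturated _ (Or.inr hnS)).2 (ih (by omega))
  have hout : ∀ m, n ≤ m → m ≤ K → E.face ((E.rot ^ m) d) ∉ F := by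
    intro m hnm
    induction m, hnm using Nat.le_induction with
    | base =>
      intro _
      -- The edge `ay` is on exactly one of the two paths, so exactly one of its sides is in `F`,
      -- namely the side just before it.
      have hprev : E.face ((E.rot ^ n) d).symm ∈ F := by
        obtain ⟨k, rfl⟩ : ∃ k, n = k + 1 := ⟨n - 1, by omega⟩
        rw [hsucc]
        exact hin k (Nat.lt_succ_self k)
      rw [hny] at hprev ⊢
      have hf := h.frontier ⟨(a, y), hy⟩ haS hyS
      have hyp : (⟨(a, y), hy⟩ : G.Dart).edge ∉ (E.between hx hx' hy hy' F).p.edges := by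
        simp only [between, Walk.edges_cons, Walk.edges_nil, List.mem_cons, Dart.edge_mk,
          List.not_mem_nil, or_false, Sym2.eq_iff]
        have := hx.ne
        have := hy.ne
        grind
      have hyq : (⟨(a, y), hy⟩ : G.Dart).edge ∈ (E.between hx hx' hy hy' F).q.edges := by
        simp [between]
      intro hc
      have := hf.2 (Or.inr ⟨hyq, hyp⟩)
      rcases this with ⟨-, h2⟩ | ⟨-, h2⟩
      exacts [h2 hprev, h2 hc]
    | succ m hnm ih =>
      intro hmK hc
      refine ih (by omega) ?_
      rw [← hsucc]
      refine (hcross _ (hfst _) ?_ ?_).1 hc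
      · intro hsx
        exact hnoret (m + 1) (by omega) hmK (Dart.ext _ _ (Prod.ext (hfst _) hsx))
      · intro hsy
        have heq : (E.rot ^ (m + 1)) d = (E.rot ^ n) d := by
          rw [hny]
          exact Dart.ext _ _ (Prod.ext (hfst _) hsy)
        refine hnoret (m + 1 - n) (by omega) (by omega) ?_
        apply (E.rot ^ n).injective
        rw [← Equiv.Perm.mul_apply, ← pow_add, ← heq]
        congr 2
        omega
  exact hout K hnK.le le_rfl (hKz ▸ hzF)

end SurfaceEmbedding

/-! ### Shrinking regions -/

namespace SurfaceEmbedding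

variable {V : Type u} {G : SimpleGraph V} {E : SurfaceEmbedding G}

namespace Run

variable {S : Set V} {a b : V}

theorem eq_of_incident_piece [Finite V] (r : E.Run S a b) (i : Fin r.n) {z : V} (hz : z ∈ S)
    {f : E.Face} (hf : f ∈ r.piece i) (hzf : E.Incident z f) :
    z = a ∨ z = b ∨ z = r.x i.castSucc ∨ z = r.x i.succ := by
  by_contra hno
  refine not_mem_inside_between_of_next _ _ _ _ _ ?_ (r.next i) (r.corner i) (r.simple i) z
    ⟨hz, ?_, f, hf, hzf⟩
  · exact fun h => Fin.castSucc_lt_succ.ne (r.injective h)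
  · rwa [mem_boundary_between]

/-- The face on the left of the edge `yz` lies in some piece, and the only vertices of `S` on a
piece are `a`, `b` and its two successive common neighbours. So adjacency inside a run is confined
to consecutive vertices. -/
theorem exists_piece_of_adj_inside [Finite V] (r : E.Run S a b) (h : r.region.IsSimpleRegion S)
    {y z : V} (hy : y ∈ r.region.inside S) (hz : z ∈ S) (hza : G.Adj a z) (hzb : G.Adj z b)
    (hyz : G.Adj y z) :
    ∃ i : Fin r.n, (y = r.x i.castSucc ∨ y = r.x i.succ) ∧
      (z = r.x i.castSucc ∨ z = r.x i.succ) := by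
  have hf := h.toIsRegion.face_mem_of_mem_inside hy ⟨(y, z), hyz⟩ rfl
  obtain ⟨i, hi⟩ := Set.mem_iUnion.1 hf
  obtain ⟨hay, hby⟩ := h.adj_of_mem_inside hy
  refine ⟨i, ?_, ?_⟩
  · rcases r.eq_of_incident_piece i hy.1 hi (E.incident_fst ⟨(y, z), hyz⟩) with e | e | e
    exacts [absurd e hay.ne', absurd e hby.ne', e]
  · rcases r.eq_of_incident_piece i hz hi (E.incident_snd ⟨(y, z), hyz⟩) with e | e | e
    exacts [absurd e hza.ne', absurd e hzb.ne, e]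

theorem mem_boundary_region (r : E.Run S a b) (z : V) : z ∈ r.region.boundary ↔
    z = a ∨ z = b ∨ z = r.x 0 ∨ z = r.x (Fin.last r.n) :=
  mem_boundary_between _ _ _ _ _ _

/-- Only the first piece contains `r.x 0` as a corner, so such a neighbour can only be the second
vertex of the run. -/
theorem subsingleton_adj_first [Finite V] (r : E.Run S a b) (h : r.region.IsSimpleRegion S) :
    {y ∈ r.region.inside S | G.Adj y (r.x 0)}.Subsingleton := by
  have hS : r.x 0 ∈ S := h.boundary_subset ((r.mem_boundary_region _).2 (by simp))
  have key : ∀ y ∈ r.region.inside S, G.Adj y (r.x 0) →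
      ∃ i : Fin r.n, i.castSucc = 0 ∧ y = r.x i.succ := by
    intro y hy hadj
    obtain ⟨i, h1, h2⟩ := r.exists_piece_of_adj_inside h hy hS (r.adj_left 0) (r.adj_right 0) hadj
    rcases h2 with h2 | h2
    · have h0 := r.injective h2
      refine ⟨i, h0.symm, h1.resolve_left ?_⟩
      rw [← h0]
      exact hadj.ne
    · exact absurd (r.injective h2).symm (Fin.succ_ne_zero i)
  rintro y ⟨hy, hya⟩ y' ⟨hy', hya'⟩
  obtain ⟨i, hi, rfl⟩ := key y hy hya
  obtain ⟨j, hj, rfl⟩ := key y' hy' hya'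
  rw [Fin.castSucc_injective _ (hi.trans hj.symm)]

theorem subsingleton_adj_last [Finite V] (r : E.Run S a b) (h : r.region.IsSimpleRegion S) :
    {y ∈ r.region.inside S | G.Adj y (r.x (Fin.last r.n))}.Subsingleton := by
  have hS : r.x (Fin.last r.n) ∈ S := h.boundary_subset ((r.mem_boundary_region _).2 (by simp))
  have key : ∀ y ∈ r.region.inside S, G.Adj y (r.x (Fin.last r.n)) →
      ∃ i : Fin r.n, i.succ = Fin.last r.n ∧ y = r.x i.castSucc := by
    intro y hy hadj
    obtain ⟨i, h1, h2⟩ := r.exists_piece_of_adj_inside h hy hS (r.adj_left _) (r.adj_right _) hadj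
    rcases h2 with h2 | h2
    · exact absurd (r.injective h2).symm (Fin.castSucc_lt_last i).ne
    · have h0 := r.injective h2
      refine ⟨i, h0.symm, h1.resolve_right ?_⟩
      rw [← h0]
      exact hadj.ne
  rintro y ⟨hy, hya⟩ y' ⟨hy', hya'⟩
  obtain ⟨i, hi, rfl⟩ := key y hy hya
  obtain ⟨j, hj, rfl⟩ := key y' hy' hya'
  rw [Fin.succ_injective _ (hi.trans hj.symm)]

/-- Deleting a vertex strictly inside a simple region with more than seven vertices does not
change the total domination number. -/
theorem totalDominationNumber_diff_inside [Finite V] (r : E.Run S a b)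
    (h : r.region.IsSimpleRegion S) {T : Set V} (hTS : T ⊆ S) (ha : a ∈ T)
    (hcard : 7 < (r.region.verts T).encard) {x : V} (hx : x ∈ r.region.inside T) :
    totalDominationNumber (G.induce T) = totalDominationNumber (G.induce (T \ {x})) := by
  -- The run and its region come from `S`, before any deletion; the adjacency bounds pass to the
  -- vertices that remain in `T`.
  have hIT : r.region.inside T ⊆ r.region.inside S := r.region.inside_mono hTS
  refine totalDominationNumber_induce_diff_singleton G (I := r.region.inside T) (b := b)
    (p := r.x 0) (q := r.x (Fin.last r.n)) ha (fun y hy => hy.1)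
    (fun y hy => h.adj_of_mem_inside (hIT hy)) ⟨r.adj_left _, (r.adj_right _).symm⟩
    ⟨r.adj_left _, (r.adj_right _).symm⟩ ?_
    ((r.subsingleton_adj_first h).anti fun y hy => ⟨hIT hy.1, hy.2⟩)
    ((r.subsingleton_adj_last h).anti fun y hy => ⟨hIT hy.1, hy.2⟩) ?_ hx
  · intro y hy z hz hyz
    rcases h.toIsRegion.mem_verts_of_adj (hIT hy) (hTS hz) hyz with hzv | hzv
    · have := (r.mem_boundary_region z).1 hzv.1
      tauto
    · exact Or.inr (Or.inr (Or.inr (Or.inr ⟨hz, hzv.2⟩)))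
  -- With at most three inner vertices, the region would have size at most 4 + 3, the boundary being
  -- `a`, `b` and the two ends of the run.
  · by_contra! hlt
    have hI3 : (r.region.inside T).encard ≤ 3 := Order.le_of_lt_add_one (hlt.trans_eq (by norm_num))
    have hb4 : r.region.boundary.encard ≤ 4 := by
      have hsub : r.region.boundary ⊆ {a, b, r.x 0, r.x (Fin.last r.n)} := fun z hz =>
        (r.mem_boundary_region z).1 hz
      refine (Set.encard_le_encard hsub).trans ((Set.encard_insert_le _ _).trans ?_)
      have h3 : ({b, r.x 0, r.x (Fin.last r.n)} : Set V).encard ≤ 1 + 1 + 1 :=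
        (Set.encard_insert_le _ _).trans (by
          gcongr
          exact (Set.encard_insert_le _ _).trans (by rw [Set.encard_singleton]))
      calc _ ≤ (1 + 1 + 1 + 1 : ℕ∞) := by gcongr
        _ ≤ 4 := by norm_num
    have h7 : (r.region.verts T).encard ≤ 4 + 3 :=
      (Set.encard_union_le _ _).trans
        (add_le_add ((Set.encard_le_encard Set.inter_subset_left).trans hb4) hI3)
    exact absurd (hcard.trans_le h7) (by norm_num)

end Run

/-- A vertex that is never strictly inside a region of the family survives the shrinking. -/
theorem Shrink.mem_of_not_mem_inside {𝓡 : Set E.Region} {S T : Set V} (h : E.Shrink 𝓡 S T)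
    {z : V} (hz : z ∈ S) (hz' : ∀ R ∈ 𝓡, z ∉ R.inside S) : z ∈ T := by
  have key : ∀ U, Relation.ReflTransGen (E.ShrinkStep 𝓡) S U → U ⊆ S ∧ z ∈ U := by
    intro U hU
    induction hU with
    | refl => exact ⟨subset_rfl, hz⟩
    | tail _ hstep ih =>
      obtain ⟨R, hR, -, x, hx, rfl⟩ := hstep
      refine ⟨Set.sdiff_subset.trans ih.1, ih.2, ?_⟩
      rintro rfl
      exact hz' R hR (R.inside_mono ih.1 hx)
  exact (key T h.1).2

/-- Shrinking simple regions with a common first extremity does not change the total domination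
number. -/
theorem Shrink.totalDominationNumber_eq [Finite V] {𝓡 : Set E.Region} {S T : Set V} {a : V}
    (h : E.Shrink 𝓡 S T) (h𝓡 : ∀ R ∈ 𝓡, ∃ b, R ∈ E.runRegions S a b) :
    totalDominationNumber (G.induce S) = totalDominationNumber (G.induce T) := by
  have ha : ∀ R ∈ 𝓡, a ∈ R.boundary ∧ a ∈ S := by
    intro R hR
    obtain ⟨b, r, rfl, hr⟩ := h𝓡 R hR
    have : a ∈ r.region.boundary := (r.mem_boundary_region a).2 (Or.inl rfl)
    exact ⟨this, hr.boundary_subset this⟩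
  -- The vertex `a` is on the boundary of every region of the family, hence never deleted. The
  -- implication `a ∈ S → a ∈ U` allows for an empty family, for which `a ∈ S` is not known.
  have key : ∀ U, Relation.ReflTransGen (E.ShrinkStep 𝓡) S U → U ⊆ S ∧ (a ∈ S → a ∈ U) ∧
      totalDominationNumber (G.induce S) = totalDominationNumber (G.induce U) := by
    intro U hU
    induction hU with
    | refl => exact ⟨subset_rfl, id, rfl⟩
    | tail _ hstep ih =>
      obtain ⟨R, hR, hcard, x, hx, rfl⟩ := hstep
      refine ⟨Set.sdiff_subset.trans ih.1, fun haS => ⟨ih.2.1 haS, ?_⟩, ?_⟩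
      · rintro rfl
        exact hx.2.1 (ha R hR).1
      · obtain ⟨b, r, rfl, hr⟩ := h𝓡 R hR
        exact ih.2.2.trans
          (r.totalDominationNumber_diff_inside hr ih.1 (ih.2.1 (ha _ hR).2) hcard hx)
  exact (key T h.1).2.2

end SurfaceEmbedding

/-! ### Dominating the neighbourhood of a pair -/

section PairNeighborhood

variable {V : Type u} {G : SimpleGraph V} {v w : V}

theorem pairN_comm (G : SimpleGraph V) (v w : V) : pairN G v w = pairN G w v := by
  simp only [pairN, Set.union_comm, Set.pair_comm]

theorem pairN1_comm (G : SimpleGraph V) (v w : V) : pairN1 G v w = pairN1 G w v := by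
  simp only [pairN1, pairN_comm G v w, Set.pair_comm v w]

theorem pairN2_comm (G : SimpleGraph V) (v w : V) : pairN2 G v w = pairN2 G w v := by
  simp only [pairN2, pairN_comm G v w, pairN1_comm G v w]

theorem pairN3_comm (G : SimpleGraph V) (v w : V) : pairN3 G v w = pairN3 G w v := by
  simp only [pairN3, pairN_comm G v w, pairN1_comm G v w, pairN2_comm G v w]

theorem pairRuleApplicable_comm (h : SurfaceEmbedding.PairRuleApplicable G v w) :
    SurfaceEmbedding.PairRuleApplicable G w v := by
  unfold SurfaceEmbedding.PairRuleApplicable at h ⊢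
  rwa [pairN2_comm G w v, pairN3_comm G w v]

theorem mem_pairN_of_mem_pairN23 {x : V} (hx : x ∈ pairN2 G v w ∪ pairN3 G v w) :
    x ∈ pairN G v w ∧ x ∉ pairN1 G v w := by
  rcases hx with hx | hx
  exacts [hx.1, ⟨hx.1, fun h => hx.2 (Or.inl h)⟩]

theorem mem_of_adj_pairN23 {x y : V} (hx : x ∈ pairN2 G v w ∪ pairN3 G v w)
    (hxy : G.Adj x y) : y ∈ pairN G v w ∪ {v, w} := by
  obtain ⟨h, h1⟩ := mem_pairN_of_mem_pairN23 hx
  by_contra hy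
  exact h1 ⟨h, y, hxy, hy⟩

/-- A neighbour in `N₁(v,w)` would put `x` in `N₂(v,w)`. Hence only `v`, `w` and `N₂₃(v,w)` can
dominate `N₃(v,w)`. -/
theorem mem_of_adj_pairN3 {x y : V} (hx : x ∈ pairN3 G v w) (hxy : G.Adj x y) :
    y ∈ pairN2 G v w ∪ pairN3 G v w ∪ {v, w} := by
  rcases mem_of_adj_pairN23 (Or.inr hx) hxy with hy | hy
  · left
    have hx1 : x ∉ pairN1 G v w := fun h => hx.2 (Or.inl h)
    have hy1 : y ∉ pairN1 G v w := fun h => hx.2 (Or.inr ⟨⟨hx.1, hx1⟩, y, hxy, h⟩)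
    by_cases hy2 : y ∈ pairN2 G v w
    exacts [Or.inl hy2, Or.inr ⟨hy, fun h => h.elim hy1 hy2⟩]
  · exact Or.inr hy

/-- Otherwise `w` alone would dominate `N₃(v,w)`, and `{w}` would belong to `𝒟_w`. -/
theorem exists_adj_mem_pairN3 (hw : dominatorsWith G w v = ∅) :
    ∃ x ∈ pairN3 G v w, G.Adj v x := by
  by_contra! hno
  refine Set.eq_empty_iff_forall_notMem.1 hw {w} ⟨Set.subset_union_right, fun x hx => ?_, ?_,
    rfl⟩
  · rw [pairN3_comm] at hx
    simpa using hx.1.1.resolve_left (hno x hx)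
  · rw [Set.encard_singleton]
    norm_num

theorem pair_notMem_pairN23 :
    v ∉ pairN2 G v w ∪ pairN3 G v w ∧ w ∉ pairN2 G v w ∪ pairN3 G v w :=
  ⟨fun h => (mem_pairN_of_mem_pairN23 h).1.2 (by simp),
    fun h => (mem_pairN_of_mem_pairN23 h).1.2 (by simp)⟩

/-- As `v ∉ D`, the set `D ∩ N₂₃(v,w)` together with `w` dominates `N₃(v,w)`; with at most two
vertices in the intersection it would be a member of `𝒟_w`. -/
theorem three_le_encard_inter (hw : dominatorsWith G w v = ∅) {D : Set V}
    (hD : IsTotalDominatingSet G D) (hvD : v ∉ D) :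
    3 ≤ (D ∩ (pairN2 G v w ∪ pairN3 G v w)).encard := by
  by_contra! hlt
  refine Set.eq_empty_iff_forall_notMem.1 hw
    (insert w (D ∩ (pairN2 G v w ∪ pairN3 G v w))) ⟨?_, fun x hx => ?_, ?_, Set.mem_insert _ _⟩
  · rw [pairN2_comm G w v, pairN3_comm G w v]
    exact Set.insert_subset (Or.inr rfl) fun x hx => Or.inl hx.2
  · rw [pairN3_comm] at hx
    obtain ⟨y, hy, hxy⟩ := hD x
    refine Set.mem_iUnion₂.2 ⟨y, ?_, hxy.symm⟩
    rcases mem_of_adj_pairN3 hx hxy with h | rfl | rfl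
    exacts [Or.inr ⟨hy, h⟩, absurd hy hvD, Or.inl rfl]
  · refine (Set.encard_insert_le _ _).trans ?_
    exact Order.add_one_le_of_lt hlt

theorem four_le_encard_inter (h : SurfaceEmbedding.PairRuleApplicable G v w) {D : Set V}
    (hD : IsTotalDominatingSet G D) (hvD : v ∉ D) (hwD : w ∉ D) :
    4 ≤ (D ∩ (pairN2 G v w ∪ pairN3 G v w)).encard := by
  by_contra! hlt
  have hnb : ∀ x ∈ pairN3 G v w, ∃ y ∈ D ∩ (pairN2 G v w ∪ pairN3 G v w), G.Adj x y := by
    intro x hx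
    obtain ⟨y, hy, hxy⟩ := hD x
    rcases mem_of_adj_pairN3 hx hxy with hm | rfl | rfl
    exacts [⟨y, ⟨hy, hm⟩, hxy⟩, absurd hy hvD, absurd hy hwD]
  -- Keeping only the vertices with a neighbour in `N₃(v,w)` gives the inclusion in `S ∪ N(S)` that
  -- `IsTotalDominatingSetOf` demands.
  refine h ⟨{y ∈ D ∩ (pairN2 G v w ∪ pairN3 G v w) | ∃ x ∈ pairN3 G v w, G.Adj x y},
    fun y hy => hy.1.2, ?_, fun y hy => Or.inr hy.2, ?_, ?_⟩
  · refine (Set.encard_le_encard fun y hy => hy.1).trans ?_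
    exact Order.le_of_lt_add_one (hlt.trans_eq (by norm_num))
  · intro x hx
    obtain ⟨y, hy, hxy⟩ := hnb x hx
    exact ⟨y, ⟨hy, x, hx, hxy⟩, hxy⟩
  · intro x _ hx
    obtain ⟨y, hy, hxy⟩ := hnb x hx
    exact ⟨y, ⟨hy, x, hx, hxy⟩, hxy⟩

/-- Trade `D ∩ N₂₃(v,w)` for `v`, `w` and neighbours `p`, `q` of `v`, `w` in `D`: the pair dominates
`N(v,w)`, and `p`, `q` dominate the pair. If `w ∈ D`, three vertices are added and at least three
dropped; if not, four and at least four. -/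
theorem exists_isTotalDominatingSet_pair_subset
    (h : SurfaceEmbedding.PairRuleApplicable G v w) (hw : dominatorsWith G w v = ∅) {D : Set V}
    (hD : IsTotalDominatingSet G D) (hvD : v ∉ D) :
    ∃ D', IsTotalDominatingSet G D' ∧ v ∈ D' ∧ w ∈ D' ∧ D'.encard ≤ D.encard := by
  obtain ⟨p, -, hvp⟩ := hD v
  obtain ⟨q, -, hwq⟩ := hD w
  have hdom : ∀ D' : Set V, D \ (pairN2 G v w ∪ pairN3 G v w) ⊆ D' → v ∈ D' → w ∈ D' → p ∈ D' →
      q ∈ D' → IsTotalDominatingSet G D' := by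
    intro D' hDD' hv' hw' hp hq x
    by_cases hxN : x ∈ pairN G v w ∪ {v, w}
    · rcases hxN with ⟨hx | hx, -⟩ | rfl | rfl
      exacts [⟨v, hv', hx.symm⟩, ⟨w, hw', hx.symm⟩, ⟨p, hp, hvp⟩, ⟨q, hq, hwq⟩]
    · obtain ⟨y, hy, hxy⟩ := hD x
      exact ⟨y, hDD' ⟨hy, fun hy' => hxN (mem_of_adj_pairN23 hy' hxy.symm)⟩, hxy⟩
  have h3 : ({v, p, q} : Set V).encard ≤ 3 := by
    calc _ ≤ (1 + 1 + 1 : ℕ∞) := (Set.encard_insert_le _ _).trans (by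
          gcongr
          exact (Set.encard_insert_le _ _).trans (by rw [Set.encard_singleton]))
      _ = 3 := by norm_num
  by_cases hwD : w ∈ D
  · refine ⟨(D \ (pairN2 G v w ∪ pairN3 G v w)) ∪ {v, p, q}, ?_, by simp,
      Or.inl ⟨hwD, pair_notMem_pairN23.2⟩,
      encard_diff_union_le (h3.trans (three_le_encard_inter hw hD hvD))⟩
    exact hdom _ Set.subset_union_left (by simp) (Or.inl ⟨hwD, pair_notMem_pairN23.2⟩) (by simp)
      (by simp)
  · refine ⟨(D \ (pairN2 G v w ∪ pairN3 G v w)) ∪ {w, v, p, q}, ?_, by simp, by simp,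
      encard_diff_union_le (le_trans ?_ (four_le_encard_inter h hD hvD hwD))⟩
    · exact hdom _ Set.subset_union_left (by simp) (by simp) (by simp) (by simp)
    · calc _ ≤ (3 + 1 : ℕ∞) := (Set.encard_insert_le _ _).trans (by gcongr)
        _ = 4 := by norm_num

end PairNeighborhood

/-! ### Both families are empty -/

section AddThree

variable {V : Type u} {G : SimpleGraph V} {v w : V}

theorem totalDominationNumber_addThree_le
    (h : SurfaceEmbedding.PairRuleApplicable G v w) (hv : dominatorsWith G v w = ∅)
    (hw : dominatorsWith G w v = ∅) :
    totalDominationNumber ((addThree G v w).induce (case1Verts G v w)) ≤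
      totalDominationNumber G := by
  rw [totalDominationNumber_eq_induce_univ G]
  refine totalDominationNumber_induce_le fun D hD => ?_
  replace hD : IsTotalDominatingSet G D := fun x => hD.2 x trivial
  obtain ⟨D₁, hD₁, hvD₁, hwD₁, hle⟩ : ∃ D', IsTotalDominatingSet G D' ∧ v ∈ D' ∧ w ∈ D' ∧
      D'.encard ≤ D.encard := by
    by_cases hvD : v ∈ D
    · by_cases hwD : w ∈ D
      · exact ⟨D, hD, hvD, hwD, le_rfl⟩
      · obtain ⟨D', h1, h2, h3, h4⟩ :=
          exists_isTotalDominatingSet_pair_subset (pairRuleApplicable_comm h) hv hD hwD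
        exact ⟨D', h1, h3, h2, h4⟩
    · exact exists_isTotalDominatingSet_pair_subset h hw hD hvD
  have hv3 : v ∉ pairN3 G v w := fun h => pair_notMem_pairN23.1 (Or.inr h)
  have hw3 : w ∉ pairN3 G v w := fun h => pair_notMem_pairN23.2 (Or.inr h)
  -- Since `v` and `w` are in `D₁`, dropping `D₁ ∩ N₃(v,w)` can leave only `v` and `w` undominated.
  -- The set `B` repairs this: `v'` and `w'` if at least two vertices are dropped; if only one is,
  -- then `y`, `v'` or `w'` according to which of `v`, `w` it dominates.
  suffices hB : ∃ B : Set NewVertex, B.encard ≤ (D₁ ∩ pairN3 G v w).encard ∧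
      (NewVertex.y ∈ B → ∃ x ∈ pairN3 G v w, G.Adj v x ∧ G.Adj w x) ∧
      ((∃ z ∈ D₁ ∩ pairN3 G v w, G.Adj v z) → NewVertex.v' ∈ B ∨ NewVertex.y ∈ B) ∧
      ((∃ z ∈ D₁ ∩ pairN3 G v w, G.Adj w z) → NewVertex.w' ∈ B ∨ NewVertex.y ∈ B) by
    obtain ⟨B, hcard, hy, hBv, hBw⟩ := hB
    refine ⟨Sum.inl '' (D₁ \ pairN3 G v w) ∪ Sum.inr '' B, ⟨?_, ?_⟩, ?_⟩
    · rintro _ (⟨x, hx, rfl⟩ | ⟨z, hz, rfl⟩)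
      · exact hx.2
      · cases z
        exacts [trivial, trivial, hy hz]
    · have hvm : Sum.inl v ∈ Sum.inl '' (D₁ \ pairN3 G v w) ∪ Sum.inr '' B :=
        Or.inl ⟨v, ⟨hvD₁, hv3⟩, rfl⟩
      have hwm : Sum.inl w ∈ Sum.inl '' (D₁ \ pairN3 G v w) ∪ Sum.inr '' B :=
        Or.inl ⟨w, ⟨hwD₁, hw3⟩, rfl⟩
      rintro (x | z) hx
      · by_cases hxN : x ∈ pairN G v w
        · rcases hxN.1 with h | h
          · exact ⟨_, hvm, by simp [addThree, h.symm, h.ne']⟩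
          · exact ⟨_, hwm, by simp [addThree, h.symm, h.ne']⟩
        obtain ⟨y, hyD, hxy⟩ := hD₁ x
        by_cases hy3 : y ∈ pairN3 G v w
        · rcases mem_of_adj_pairN23 (Or.inr hy3) hxy.symm with h | rfl | rfl
          · exact absurd h hxN
          · rcases hBv ⟨y, ⟨hyD, hy3⟩, hxy⟩ with h | h
            exacts [⟨_, Or.inr ⟨_, h, rfl⟩, by simp [addThree]⟩,
              ⟨_, Or.inr ⟨_, h, rfl⟩, by simp [addThree]⟩]
          · rcases hBw ⟨y, ⟨hyD, hy3⟩, hxy⟩ with h | h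
            exacts [⟨_, Or.inr ⟨_, h, rfl⟩, by simp [addThree]⟩,
              ⟨_, Or.inr ⟨_, h, rfl⟩, by simp [addThree]⟩]
        · refine ⟨_, Or.inl ⟨y, ⟨hyD, hy3⟩, rfl⟩, ?_⟩
          simp [addThree, hxy, hxy.ne]
      · cases z
        exacts [⟨_, hvm, by simp [addThree]⟩, ⟨_, hwm, by simp [addThree]⟩,
          ⟨_, hvm, by simp [addThree]⟩]
    · refine le_trans ?_ hle
      rw [← Set.encard_sdiff_add_encard_inter D₁ (pairN3 G v w)]
      refine (Set.encard_union_le _ _).trans (add_le_add (Set.encard_image_le _ _) ?_)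
      exact (Set.encard_image_le _ _).trans hcard
  by_cases h0 : D₁ ∩ pairN3 G v w = ∅
  · exact ⟨∅, by simp, by simp, by simp [h0], by simp [h0]⟩
  by_cases h1 : 2 ≤ (D₁ ∩ pairN3 G v w).encard
  · exact ⟨{.v', .w'}, (Set.encard_pair (by simp)).trans_le h1, by simp, by simp, by simp⟩
  obtain ⟨z, hz⟩ := Set.nonempty_iff_ne_empty.2 h0
  have hz1 : ∀ z' ∈ D₁ ∩ pairN3 G v w, z' = z := by
    have : (D₁ ∩ pairN3 G v w).encard ≤ 1 :=
      Order.le_of_lt_add_one ((not_le.1 h1).trans_eq (by norm_num))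
    exact fun z' hz' => Set.encard_le_one_iff.1 this _ _ hz' hz
  have hone : 1 ≤ (D₁ ∩ pairN3 G v w).encard := Set.one_le_encard_iff_nonempty.2 ⟨z, hz⟩
  have hone' : ∀ k : NewVertex, ({k} : Set NewVertex).encard ≤ (D₁ ∩ pairN3 G v w).encard :=
    fun k => by rwa [Set.encard_singleton]
  by_cases hzv : G.Adj v z
  · by_cases hzw : G.Adj w z
    · exact ⟨{.y}, hone' _, fun _ => ⟨z, hz.2, hzv, hzw⟩, by simp, by simp⟩
    · refine ⟨{.v'}, hone' _, by simp, by simp, ?_⟩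
      rintro ⟨z', hz', hadj⟩
      exact absurd (hz1 z' hz' ▸ hadj) hzw
  · refine ⟨{.w'}, hone' _, by simp, ?_, by simp⟩
    rintro ⟨z', hz', hadj⟩
    exact absurd (hz1 z' hz' ▸ hadj) hzv

theorem totalDominationNumber_le_addThree (hv : dominatorsWith G v w = ∅)
    (hw : dominatorsWith G w v = ∅) :
    totalDominationNumber G ≤
      totalDominationNumber ((addThree G v w).induce (case1Verts G v w)) := by
  rw [totalDominationNumber_eq_induce_univ G]
  refine totalDominationNumber_induce_le fun D hD => ?_
  obtain ⟨p, -, hp⟩ := exists_adj_mem_pairN3 hw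
  obtain ⟨q, -, hq⟩ := exists_adj_mem_pairN3 hv
  obtain ⟨r, hr⟩ : ∃ r, (∃ x ∈ pairN3 G v w, G.Adj v x ∧ G.Adj w x) → G.Adj v r ∧ G.Adj w r := by
    by_cases hex : ∃ x ∈ pairN3 G v w, G.Adj v x ∧ G.Adj w x
    · obtain ⟨x, -, hx⟩ := hex
      exact ⟨x, fun _ => hx⟩
    · exact ⟨v, fun h => absurd h hex⟩
  -- Each new vertex is sent to an old one adjacent to all of its neighbours. The images of `v'` and
  -- `w'` exist because both families are empty, and the pendants force `v` and `w` into `D`, which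
  -- then dominate the restored `N₃(v,w)`.
  let f : V ⊕ NewVertex → V := Sum.elim id
    (fun | .v' => p | .w' => q | .y => r)
  have hf : ∀ x, ∀ z ∈ case1Verts G v w, (addThree G v w).Adj (.inl x) z → G.Adj x (f z) := by
    rintro x (a | z) hz hxz
    · have : x ≠ a ∧ (G.Adj x a ∨ G.Adj a x) := by simpa [addThree] using hxz
      exact this.2.elim id SimpleGraph.Adj.symm
    · cases z
      · have : x = v := by simpa [addThree] using hxz
        exact this ▸ hp
      · have : x = w := by simpa [addThree] using hxz
        exact this ▸ hq
      · have : x = v ∨ x = w := by simpa [addThree] using hxz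
        rcases this with rfl | rfl
        exacts [(hr hz).1, (hr hz).2]
  have hvD : v ∈ f '' D := by
    obtain ⟨z, hz, hadj⟩ := hD.2 (.inr .v') trivial
    refine ⟨z, hz, ?_⟩
    rcases z with a | z
    · simpa [addThree, f] using hadj
    · cases z <;> simp [addThree] at hadj
  have hwD : w ∈ f '' D := by
    obtain ⟨z, hz, hadj⟩ := hD.2 (.inr .w') trivial
    refine ⟨z, hz, ?_⟩
    rcases z with a | z
    · simpa [addThree, f] using hadj
    · cases z <;> simp [addThree] at hadj
  refine ⟨f '' D, ⟨Set.subset_univ _, fun x _ => ?_⟩, Set.encard_image_le _ _⟩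
  by_cases hx : x ∈ pairN3 G v w
  · rcases hx.1.1 with h | h
    exacts [⟨v, hvD, h.symm⟩, ⟨w, hwD, h.symm⟩]
  · obtain ⟨z, hz, hadj⟩ := hD.2 (.inl x) hx
    exact ⟨f z, ⟨z, hz, rfl⟩, hf x z (hD.1 hz) hadj⟩

end AddThree

/-! ### One of the families is empty -/

section AddPendant

variable {V : Type u} {G : SimpleGraph V} {v w : V}

theorem addPendant_adj_some_none {x : V} : (addPendant G v).Adj (some x) none ↔ x = v := Iff.rfl

theorem addPendant_adj_none_some {x : V} : (addPendant G v).Adj none (some x) ↔ x = v := Iff.rfl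

theorem addPendant_adj_some_some {x y : V} :
    (addPendant G v).Adj (some x) (some y) ↔ G.Adj x y := Iff.rfl

/-- Vertices that dominate only vertices dominated by `v`, besides `v` itself, are not needed in the
presence of a pendant vertex at `v`. -/
theorem totalDominationNumber_addPendant_diff {S : Set (Option V)} {Z : Set V}
    (hv : some v ∈ S) (hnone : none ∈ S) (hvZ : v ∉ Z)
    (hZ : ∀ z ∈ Z, G.Adj v z ∧ ∀ y, G.Adj z y → y = v ∨ G.Adj v y) :
    totalDominationNumber ((addPendant G v).induce S) =
      totalDominationNumber ((addPendant G v).induce (S \ some '' Z)) := by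
  have hnoneZ : (none : Option V) ∉ some '' Z := by simp
  have hvZ' : some v ∉ some '' Z := by simpa using hvZ
  have hvD : ∀ {T D : Set (Option V)}, none ∈ T →
      IsTotalDominatingSetIn (addPendant G v) T D → some v ∈ D := by
    intro T D hT hD
    obtain ⟨z | z, hz, hadj⟩ := hD.2 none hT
    · exact absurd hadj ((addPendant G v).loopless.irrefl none)
    · exact addPendant_adj_none_some.1 hadj ▸ hz
  apply le_antisymm
  · refine totalDominationNumber_induce_le fun D hD => ?_
    have hv' := hvD (show none ∈ S \ some '' Z from ⟨hnone, hnoneZ⟩) hD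
    refine ⟨D, ⟨hD.1.trans Set.sdiff_subset, fun s hs => ?_⟩, le_rfl⟩
    by_cases hsZ : s ∈ some '' Z
    · obtain ⟨z, hz, rfl⟩ := hsZ
      exact ⟨some v, hv', addPendant_adj_some_some.2 (hZ z hz).1.symm⟩
    · exact hD.2 s ⟨hs, hsZ⟩
  · refine totalDominationNumber_induce_le fun D hD => ?_
    have hv' := hvD hnone hD
    by_cases hDZ : (D ∩ some '' Z).Nonempty
    -- The pendant vertex replaces all of `D ∩ Z` at once: only `v` can lose its dominator, the
    -- other neighbours of `Z` being dominated by `v`.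
    · refine ⟨(D \ some '' Z) ∪ {none}, ⟨?_, fun s hs => ?_⟩, encard_diff_union_le ?_⟩
      · rintro s (hs | rfl)
        exacts [⟨hD.1 hs.1, hs.2⟩, ⟨hnone, hnoneZ⟩]
      · obtain ⟨y, hy, hsy⟩ := hD.2 s hs.1
        by_cases hyZ : y ∈ some '' Z
        · obtain ⟨z, hz, rfl⟩ := hyZ
          rcases s with _ | s
          · exact absurd (addPendant_adj_none_some.1 hsy ▸ hz) hvZ
          rcases (hZ z hz).2 s (addPendant_adj_some_some.1 hsy).symm with rfl | h
          · exact ⟨none, Or.inr rfl, addPendant_adj_some_none.2 rfl⟩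
          · exact ⟨some v, Or.inl ⟨hv', hvZ'⟩, addPendant_adj_some_some.2 h.symm⟩
        · exact ⟨y, Or.inl ⟨hy, hyZ⟩, hsy⟩
      · rw [Set.encard_singleton]
        exact Set.one_le_encard_iff_nonempty.2 hDZ
    · refine ⟨D, ⟨fun s hs => ⟨hD.1 hs, fun h => hDZ ⟨s, hs, h⟩⟩, fun s hs => hD.2 s hs.1⟩, le_rfl⟩

/-- A pendant vertex can be added at a non-isolated vertex that belongs to some smallest total
dominating set. -/
theorem totalDominationNumber_addPendant {p : V} (hp : G.Adj v p)
    (h : ∀ D, IsTotalDominatingSet G D →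
      ∃ D', IsTotalDominatingSet G D' ∧ v ∈ D' ∧ D'.encard ≤ D.encard) :
    totalDominationNumber G = totalDominationNumber ((addPendant G v).induce Set.univ) := by
  rw [totalDominationNumber_eq_induce_univ G]
  apply le_antisymm
  · refine totalDominationNumber_induce_le fun D hD => ?_
    refine ⟨(fun z => z.getD p) '' D, ⟨Set.subset_univ _, fun x _ => ?_⟩, Set.encard_image_le _ _⟩
    obtain ⟨z | z, hz, hadj⟩ := hD.2 (some x) trivial
    · exact ⟨p, ⟨none, hz, rfl⟩, addPendant_adj_some_none.1 hadj ▸ hp⟩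
    · exact ⟨z, ⟨some z, hz, rfl⟩, addPendant_adj_some_some.1 hadj⟩
  · refine totalDominationNumber_induce_le fun D hD => ?_
    obtain ⟨D', hD', hvD', hle⟩ := h D fun x => hD.2 x trivial
    refine ⟨some '' D', ⟨Set.subset_univ _, ?_⟩, (Set.encard_image_le _ _).trans hle⟩
    rintro (_ | x) -
    · exact ⟨some v, ⟨v, hvD', rfl⟩, addPendant_adj_none_some.2 rfl⟩
    · obtain ⟨y, hy, hxy⟩ := hD' x
      exact ⟨some y, ⟨y, hy, rfl⟩, addPendant_adj_some_some.2 hxy⟩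

theorem adj_of_mem_vertexN23 {z : V} (hz : z ∈ vertexN2 G v ∪ vertexN3 G v) :
    G.Adj v z ∧ ∀ y, G.Adj z y → y = v ∨ G.Adj v y := by
  have hz' : G.Adj v z ∧ z ∉ vertexN1 G v := by
    rcases hz with hz | hz
    exacts [hz.1, ⟨hz.1, fun h => hz.2 (Or.inl h)⟩]
  refine ⟨hz'.1, fun y hzy => ?_⟩
  by_contra! hy
  exact hz'.2 ⟨hz'.1, y, hzy, fun h => h.elim hy.2 hy.1⟩

end AddPendant

/-! ### The rule -/

namespace SurfaceEmbedding

variable {V : Type u} {G : SimpleGraph V} {E : SurfaceEmbedding G}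

theorem PairRuleOneSided.totalDominationNumber_eq [Finite V] {v w : V} (hvw : v ≠ w)
    (h : PairRuleApplicable G v w) (hw : dominatorsWith G w v = ∅) {W : Type u}
    {G' : SimpleGraph W} (hG' : PairRuleOneSided E v w W G') :
    totalDominationNumber G = totalDominationNumber G' := by
  obtain ⟨E', -, D, -, 𝓡₁, h𝓡₁, S₁, hS₁, T, hT, 𝓡₂, h𝓡₂, S₂, hS₂⟩ := hG'
  obtain ⟨p, -, hp⟩ := exists_adj_mem_pairN3 hw
  have h𝓡₁' : ∀ R ∈ 𝓡₁, ∃ b, R ∈ E'.runRegions Set.univ (some w) (some b) := by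
    intro R hR
    rw [h𝓡₁] at hR
    obtain ⟨x, -, hR⟩ := Set.mem_iUnion₂.1 hR
    exact ⟨x, hR.1⟩
  have h𝓡₂' : ∀ R ∈ 𝓡₂, ∃ b, R ∈ E'.runRegions T (some v) b := by
    intro R hR
    rw [h𝓡₂] at hR
    obtain ⟨_, -, hR⟩ := Set.mem_iUnion₂.1 hR
    obtain ⟨z, -, hR⟩ := Set.mem_iUnion₂.1 hR
    exact ⟨z, hR.1⟩
  -- The pendant vertex and `v` must survive the first shrinking, so that `v` stays forced. An inner
  -- pendant would be adjacent to `w`; an inner `v` would bring its pendant neighbour into the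
  -- region, where it would again be adjacent to `w`.
  have hnone : ∀ R ∈ 𝓡₁, none ∉ R.inside Set.univ := by
    intro R hR hin
    obtain ⟨b, r, rfl, hr⟩ := h𝓡₁' R hR
    exact hvw (addPendant_adj_some_none.1 (hr.adj_of_mem_inside hin).1).symm
  have hv : ∀ R ∈ 𝓡₁, some v ∉ R.inside Set.univ := by
    intro R hR hin
    obtain ⟨b, r, rfl, hr⟩ := h𝓡₁' R hR
    have hadj : (addPendant G v).Adj (some v) none := addPendant_adj_some_none.2 rfl
    rcases hr.toIsRegion.mem_verts_of_adj hin (Set.mem_univ _) hadj with hb | hb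
    · have hwn : (addPendant G v).Adj (some w) none := by
        rcases (r.mem_boundary_region none).1 hb.1 with h0 | h0 | h0 | h0
        · exact absurd h0 (by simp)
        · exact absurd h0 (by simp)
        · exact h0 ▸ r.adj_left _
        · exact h0 ▸ r.adj_left _
      exact hvw (addPendant_adj_some_none.1 hwn).symm
    · exact hnone _ hR hb
  calc totalDominationNumber G
      = totalDominationNumber ((addPendant G v).induce Set.univ) :=
        totalDominationNumber_addPendant hp fun D hD => by
          by_cases hvD : v ∈ D
          · exact ⟨D, hD, hvD, le_rfl⟩
          · obtain ⟨D', h1, h2, -, h3⟩ := exists_isTotalDominatingSet_pair_subset h hw hD hvD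
            exact ⟨D', h1, h2, h3⟩
    _ = totalDominationNumber ((addPendant G v).induce S₁) :=
        hS₁.totalDominationNumber_eq fun R hR => (h𝓡₁' R hR).imp' some fun _ => id
    _ = totalDominationNumber ((addPendant G v).induce T) := by
        rw [hT]
        exact totalDominationNumber_addPendant_diff
          (hS₁.mem_of_not_mem_inside (Set.mem_univ _) hv)
          (hS₁.mem_of_not_mem_inside (Set.mem_univ _) hnone)
          (fun hv' => hv'.2.1.2 (by simp)) (fun z hz => adj_of_mem_vertexN23 hz.1)
    _ = totalDominationNumber ((addPendant G v).induce S₂) := hS₂.totalDominationNumber_eq h𝓡₂'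

end SurfaceEmbedding

theorem lemma4 {V : Type u} [Finite V] (G : SimpleGraph V) (E : SurfaceEmbedding G) (hE : E.IsPlane)
    (v w : V) (hvw : v ≠ w) (V' : Type u) (G' : SimpleGraph V')
    (hG' : E.PairRule v w V' G') :
    totalDominationNumber G = totalDominationNumber G' := by
  cases hG' with
  | case1 h hv hw =>
    exact le_antisymm (totalDominationNumber_le_addThree hv hw)
      (totalDominationNumber_addThree_le h hv hw)
  | case2 h Dv hv Dw hw S₁ hS₁ S₂ hS₂ =>
    rw [totalDominationNumber_eq_induce_univ G]
    refine (hS₁.totalDominationNumber_eq (a := w) fun R hR => ?_).trans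
      (hS₂.totalDominationNumber_eq (a := v) fun R hR => ?_)
    all_goals
      obtain ⟨x, -, hR⟩ := Set.mem_iUnion₂.1 hR
      exact ⟨x, hR.1⟩
  | case3 h hv hw W _ hG' => exact hG'.totalDominationNumber_eq hvw h hw
  | case4 h hv hw W _ hG' =>
    exact hG'.totalDominationNumber_eq hvw.symm (pairRuleApplicable_comm h) hv
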